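/- Define polynomials $A_n, C_n \in \mathbb{R}[X]$ recursively by $A_0 = X$, $C_0 = 0$ and, for $n \ge 0$, writing $\lambda_n^k$ for the coefficient of $X^k$ in $C_n$, $$A_{n+1} = \frac{n+1}{n+2}\Big(X A_n + \sum_{k=0}^{n} \lambda_n^k A_k\Big), \qquad C_{n+1} = \frac{n+1}{n+2}\Big((X^2+1)X^n + \sum_{k=0}^{n} \lambda_n^k C_k\Big).$$ (These are polynomials for which $2ab = a^2+b^2+1$ in a complex algebra implies $ab^n = A_n(a) + C_n(b)$ and $a^n b = C_n(a) + A_n(b)$.) Then for every integer $n \ge 0$ the following hold, all integrals being absolutely convergent. (i) For every real $z$, $$(1-e^z)\int_0^{+\infty} \frac{\ln^n(t)}{(t+1)(t+e^z)}\,dt = -\pi^{n+1} A_n\!\left(\frac{z}{\pi}\right).$$ (ii) For every real $a$ with $a>0$ or $a<-1$, with $\gamma_a = \ln\left(\frac{a}{1+a}\right)$, $$\int_0^1 \frac{\ln^n\!\left(\frac{x}{1-x}\right)}{x+a}\,dx = -\pi^{n+1} A_n\!\left(\frac{\gamma_a}{\pi}\right).$$ -/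

import Mathlib

open Polynomial

noncomputable section

/-- The pair `(A_n, C_n)` of real polynomials, defined by `(A_0, C_0) = (X, 0)` and
`A_{n+1} = (n+1)/(n+2) * (X * A_n + ∑_{k=0}^n c_k A_k)`,
`C_{n+1} = (n+1)/(n+2) * ((X^2 + 1) * X^n + ∑_{k=0}^n c_k C_k)`,
where `c_k` is the coefficient of `X^k` in `C_n` (the coefficient of `X^{n+1}` in `C_n`
does not enter the sums). -/
def pairAC : ℕ → ℝ[X] × ℝ[X]
  | 0 => (X, 0)
  | n + 1 =>
    (C (((n : ℝ) + 1) / ((n : ℝ) + 2)) *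
        (X * (pairAC n).1 + ∑ k : Fin (n + 1), C ((pairAC n).2.coeff k) * (pairAC k).1),
     C (((n : ℝ) + 1) / ((n : ℝ) + 2)) *
        ((X ^ 2 + 1) * X ^ n + ∑ k : Fin (n + 1), C ((pairAC n).2.coeff k) * (pairAC k).2))
  termination_by n => n
  decreasing_by all_goals omega

/-- The polynomial `A_n`. -/
def polyA (n : ℕ) : ℝ[X] := (pairAC n).1

/-- The polynomial `C_n`. -/
def polyC (n : ℕ) : ℝ[X] := (pairAC n).2

theorem polyA_zero : polyA 0 = X := by
  rw [polyA, pairAC]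

theorem polyC_zero : polyC 0 = 0 := by
  rw [polyC, pairAC]

theorem polyA_succ (n : ℕ) :
    polyA (n + 1) = C (((n : ℝ) + 1) / ((n : ℝ) + 2)) *
      (X * polyA n + ∑ k ∈ Finset.range (n + 1), C ((polyC n).coeff k) * polyA k) := by
  rw [polyA, pairAC, Finset.sum_range]
  rfl

theorem polyC_succ (n : ℕ) :
    polyC (n + 1) = C (((n : ℝ) + 1) / ((n : ℝ) + 2)) *
      ((X ^ 2 + 1) * X ^ n + ∑ k ∈ Finset.range (n + 1), C ((polyC n).coeff k) * polyC k) := by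
  rw [polyC, pairAC, Finset.sum_range]
  rfl

end

/-! `A_n` is the only polynomial vanishing at 0 with `A_n(w + i) - A_n(w - i) = 2i w ^ n`
(`aeval_polyA_sub`, `polyA_eq_of_aeval_sub`). For `V` logistic, `P_m(z) = 𝔼[(z + V) ^ m]` solves a
rescaled form of this equation, because `𝔼[exp(sV)] = πs / sin(πs)`; hence `π ^ (n+1) A_n(z/π) =
(P_{n+1}(z) - P_{n+1}(0)) / (n+1)`.

With `t = exp u`, the kernel of (i) times `1 - exp z` is `σ(u - z) - σ(u)`, `σ` the sigmoid.
Integration by parts against `u ^ n` produces logistic densities centred at `z` and 0, hence the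
same difference of `P_{n+1}`. The substitution `x = σ(u)` turns (ii) into (i) at `z = γ_a`. -/

open Polynomial MeasureTheory ProbabilityTheory

/-! ### The difference equation characterizing `A_n` -/

theorem natDegree_polyC_le (n : ℕ) : (polyC n).natDegree ≤ n + 1 := by
  induction n using Nat.strong_induction_on with
  | _ n ih =>
    cases n with
    | zero => simp [polyC_zero]
    | succ n =>
      rw [polyC_succ]
      refine (natDegree_C_mul_le _ _).trans (natDegree_add_le_of_degree_le ?_ ?_)
      · compute_degree
        omega
      · refine natDegree_sum_le_of_forall_le _ _ fun k hk => ?_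
        have hk' := Finset.mem_range.1 hk
        exact (natDegree_C_mul_le _ _).trans ((ih k hk').trans (by omega))

/-- This is the one coefficient that the recursive sums omit. -/
theorem coeff_polyC_succ_self (n : ℕ) : (polyC n).coeff (n + 1) = (n : ℝ) / (n + 1) := by
  cases n with
  | zero => simp [polyC_zero]
  | succ n =>
    have h : ∀ k ∈ Finset.range (n + 1),
        (C ((polyC n).coeff k) * polyC k).coeff (n + 1 + 1) = 0 := fun k hk => by
      have hk' := Finset.mem_range.1 hk
      rw [coeff_C_mul, coeff_eq_zero_of_natDegree_lt
        (lt_of_le_of_lt (natDegree_polyC_le k) (by omega)), mul_zero]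
    rw [polyC_succ, coeff_C_mul, coeff_add, finsetSum_coeff, Finset.sum_eq_zero h, add_mul,
      ← pow_add, coeff_add, coeff_X_pow, one_mul, coeff_X_pow, if_pos (by omega),
      if_neg (by omega)]
    push_cast
    ring

theorem sum_coeff_polyC_mul_pow (n : ℕ) (w : ℂ) :
    ∑ k ∈ Finset.range (n + 1), (((polyC n).coeff k : ℝ) : ℂ) * w ^ k =
      aeval w (polyC n) - (n : ℂ) / (n + 1) * w ^ (n + 1) := by
  rw [aeval_eq_sum_range' (Nat.lt_succ_of_le (natDegree_polyC_le n)),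
    Finset.sum_range_succ _ (n + 1), coeff_polyC_succ_self]
  simp [Algebra.smul_def]

/-- The relation `a ^ n * b = C_n(a) + A_n(b)` for `b = a + i`. -/
theorem aeval_polyC_add_aeval_polyA (n : ℕ) (w : ℂ) :
    aeval w (polyC n) + aeval (w + Complex.I) (polyA n) = w ^ n * (w + Complex.I) := by
  induction n using Nat.strong_induction_on with
  | _ n ih =>
    cases n with
    | zero => simp [polyC_zero, polyA_zero]
    | succ n =>
      have hn := ih n (Nat.lt_succ_self n)
      have hs : ∑ k ∈ Finset.range (n + 1), (((polyC n).coeff k : ℝ) : ℂ) * aeval w (polyC k) +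
          ∑ k ∈ Finset.range (n + 1),
            (((polyC n).coeff k : ℝ) : ℂ) * aeval (w + Complex.I) (polyA k) =
          (aeval w (polyC n) - (n : ℂ) / (n + 1) * w ^ (n + 1)) * (w + Complex.I) := by
        rw [← sum_coeff_polyC_mul_pow, Finset.sum_mul, ← Finset.sum_add_distrib]
        refine Finset.sum_congr rfl fun k hk => ?_
        rw [← mul_add, ih k (Finset.mem_range.1 hk), mul_assoc]
      have h1 : (n : ℂ) + 1 ≠ 0 := by exact_mod_cast Nat.succ_ne_zero n
      have h2 : (n : ℂ) + 2 ≠ 0 := by exact_mod_cast Nat.succ_ne_zero (n + 1)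
      rw [polyC_succ, polyA_succ]
      simp only [map_mul, map_add, map_sum, aeval_C, aeval_X, map_pow, map_one, Complex.coe_algebraMap]
      set S := ∑ k ∈ Finset.range (n + 1), (((polyC n).coeff k : ℝ) : ℂ) * aeval w (polyC k)
      set T := ∑ k ∈ Finset.range (n + 1),
            (((polyC n).coeff k : ℝ) : ℂ) * aeval (w + Complex.I) (polyA k)
      push_cast
      rw [← mul_add]
      have key : (w ^ 2 + 1) * w ^ n + S + ((w + Complex.I) * aeval (w + Complex.I) (polyA n) + T)
          = (n + 2) / (n + 1) * (w ^ (n + 1) * (w + Complex.I)) := by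
        -- The 2 comes from `a ^ 2 + b ^ 2 + 1 = 2ab` with `b = a + i`; the subtracted term is the
        -- omitted top coefficient.
        have e : ((n : ℂ) + 2) / (n + 1) = 2 - n / (n + 1) := by field_simp; ring
        rw [e]
        linear_combination hs + (w + Complex.I) * hn + w ^ n * Complex.I_sq
      rw [key]
      field_simp

/-- Complex conjugate of the previous relation, the coefficients being real. -/
theorem aeval_polyC_add_aeval_polyA_sub (n : ℕ) (w : ℂ) :
    aeval w (polyC n) + aeval (w - Complex.I) (polyA n) = w ^ n * (w - Complex.I) := by
  have h := congrArg (starRingEnd ℂ) (aeval_polyC_add_aeval_polyA n (starRingEnd ℂ w))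
  simpa [← aeval_conj, sub_eq_add_neg] using h

theorem aeval_polyA_sub (n : ℕ) (w : ℂ) :
    aeval (w + Complex.I) (polyA n) - aeval (w - Complex.I) (polyA n) = 2 * Complex.I * w ^ n := by
  linear_combination aeval_polyC_add_aeval_polyA n w - aeval_polyC_add_aeval_polyA_sub n w

theorem eval_zero_polyA (n : ℕ) : (polyA n).eval 0 = 0 := by
  induction n using Nat.strong_induction_on with
  | _ n ih =>
    cases n with
    | zero => simp [polyA_zero]
    | succ n =>
      rw [polyA_succ]
      simp only [eval_mul, eval_C, eval_add, eval_X, zero_mul, zero_add, eval_finsetSum]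
      rw [Finset.sum_eq_zero fun k hk => by rw [ih k (Finset.mem_range.1 hk), mul_zero], mul_zero]

/-- Such a polynomial has period `2i`, so it vanishes at every `2ik`. -/
theorem Polynomial.eq_zero_of_aeval_add_I_eq {p : ℝ[X]} (h0 : p.eval 0 = 0)
    (h : ∀ w : ℂ, aeval (w + Complex.I) p = aeval (w - Complex.I) p) : p = 0 := by
  have hk : ∀ k : ℕ, aeval (2 * Complex.I * k) p = 0 := fun k => by
    induction k with
    | zero =>
      have h1 := aeval_algebraMap_apply_eq_algebraMap_eval (A := ℂ) 0 p
      rw [h0] at h1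
      simpa using h1
    | succ k ih =>
      have := h (2 * Complex.I * k + Complex.I)
      rw [add_sub_cancel_right, ih] at this
      rw [← this]
      push_cast
      ring_nf
  have hinf : Set.Infinite {x : ℂ | IsRoot (p.map (algebraMap ℝ ℂ)) x} := by
    refine (Set.infinite_range_of_injective (f := fun k : ℕ => 2 * Complex.I * (k : ℂ)) ?_).mono ?_
    · intro a b hab
      simpa using hab
    · rintro _ ⟨k, rfl⟩
      simpa [IsRoot, eval_map_algebraMap] using hk k
  exact (Polynomial.map_eq_zero _).1 (eq_zero_of_infinite_isRoot _ hinf)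

theorem polyA_eq_of_aeval_sub {n : ℕ} {p : ℝ[X]} (h0 : p.eval 0 = 0)
    (h : ∀ w : ℂ, aeval (w + Complex.I) p - aeval (w - Complex.I) p = 2 * Complex.I * w ^ n) :
    polyA n = p := by
  refine sub_eq_zero.1 (eq_zero_of_aeval_add_I_eq (by simp [eval_zero_polyA, h0]) fun w => ?_)
  simp only [map_sub]
  linear_combination aeval_polyA_sub n w - h w

/-! ### Moment generating function of the logistic law -/

theorem cpow_mul_one_sub_cpow_neg {x : ℝ} (hx : x ∈ Set.Ioo (0 : ℝ) 1) (s : ℂ) :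
    (x : ℂ) ^ s * (1 - (x : ℂ)) ^ (-s) = Complex.exp (s * Real.log (x / (1 - x))) := by
  have h0 : 0 < x := hx.1
  have h1 : 0 < 1 - x := sub_pos.2 hx.2
  have e : (1 - (x : ℂ)) = ((1 - x : ℝ) : ℂ) := by push_cast; rfl
  rw [e, Complex.cpow_def_of_ne_zero (by exact_mod_cast h0.ne'),
    Complex.cpow_def_of_ne_zero (by exact_mod_cast h1.ne'), ← Complex.ofReal_log h0.le,
    ← Complex.ofReal_log h1.le, ← Complex.exp_add, Real.log_div h0.ne' h1.ne']
  push_cast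
  ring_nf

/-- The logit function, which has the logistic law under the uniform measure on `(0, 1)`. -/
noncomputable def logit (x : ℝ) : ℝ := Real.log (x / (1 - x))

theorem integrableOn_cexp_mul_logit {s : ℂ} (h1 : -1 < s.re) (h2 : s.re < 1) :
    IntegrableOn (fun x : ℝ => Complex.exp (s * logit x)) (Set.Ioo 0 1) := by
  have h := Complex.betaIntegral_convergent (u := 1 + s) (v := 1 - s)
    (by simp; linarith) (by simp; linarith)
  rw [intervalIntegrable_iff_integrableOn_Ioo_of_le zero_le_one] at h
  refine h.congr_fun (fun x hx => ?_) measurableSet_Ioo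
  simpa [logit] using cpow_mul_one_sub_cpow_neg hx s

theorem integrableOn_exp_mul_logit {s : ℝ} (h1 : -1 < s) (h2 : s < 1) :
    IntegrableOn (fun x : ℝ => Real.exp (s * logit x)) (Set.Ioo 0 1) := by
  have h := (integrableOn_cexp_mul_logit (s := s) (by simpa using h1) (by simpa using h2)).re
  refine h.congr (Filter.Eventually.of_forall fun x => ?_)
  simp only [← Complex.ofReal_mul, ← Complex.ofReal_exp]
  exact Complex.ofReal_re _

theorem zero_mem_interior_integrableExpSet_logit :
    (0 : ℝ) ∈ interior (integrableExpSet logit (volume.restrict (Set.Ioo 0 1))) :=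
  mem_interior.2 ⟨Set.Ioo (-1) 1, fun _ hs => integrableOn_exp_mul_logit hs.1 hs.2, isOpen_Ioo,
    by norm_num⟩

theorem complexMGF_logit (s : ℂ) :
    complexMGF logit (volume.restrict (Set.Ioo 0 1)) s = Complex.betaIntegral (1 + s) (1 - s) := by
  rw [Complex.betaIntegral, intervalIntegral.integral_of_le zero_le_one, integral_Ioc_eq_integral_Ioo,
    complexMGF]
  refine setIntegral_congr_fun measurableSet_Ioo fun x hx => ?_
  simpa [logit] using (cpow_mul_one_sub_cpow_neg hx s).symm

/-- Euler reflection: `B(1+s, 1-s) = s Γ(s) Γ(1-s)`. The product form includes `s = 0`. -/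
theorem sin_mul_complexMGF_logit {s : ℂ} (h1 : -1 < s.re) (h2 : s.re < 1) :
    Complex.sin (Real.pi * s) * complexMGF logit (volume.restrict (Set.Ioo 0 1)) s =
      Real.pi * s := by
  rcases eq_or_ne s 0 with rfl | hs
  · simp
  have hB := Complex.Gamma_mul_Gamma_eq_betaIntegral (s := 1 + s) (t := 1 - s)
    (by simp; linarith) (by simp; linarith)
  have hsum : (1 + s) + (1 - s) = ((1 : ℕ) : ℂ) + 1 := by push_cast; ring
  rw [hsum, Complex.Gamma_nat_eq_factorial, Nat.factorial_one, Nat.cast_one, one_mul, add_comm 1 s,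
    Complex.Gamma_add_one s hs, mul_assoc, Complex.Gamma_mul_Gamma_one_sub] at hB
  have hsin : Complex.sin (Real.pi * s) ≠ 0 := by
    intro h
    obtain ⟨k, hk⟩ := Complex.sin_eq_zero_iff.1 h
    have hpi : (Real.pi : ℂ) ≠ 0 := by exact_mod_cast Real.pi_ne_zero
    have hsk : s = k := mul_left_cancel₀ hpi (by rw [hk, mul_comm])
    rw [hsk] at h1 h2 hs
    simp only [Complex.intCast_re] at h1 h2
    have h1' : -1 < k := by exact_mod_cast h1
    have h2' : k < 1 := by exact_mod_cast h2
    exact hs (by rw [show k = 0 by omega]; simp)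
  rw [complexMGF_logit, add_comm 1 s, ← hB]
  field_simp

/-! ### Logistic moments and `A_n` -/

/-- The polynomial `z ↦ 𝔼[(z + V) ^ m]`, where `V` has the logistic law. -/
noncomputable def logisticAppell (m : ℕ) : ℝ[X] :=
  ∑ k ∈ Finset.range (m + 1),
    C (m.choose k * ∫ x in Set.Ioo (0 : ℝ) 1, logit x ^ (m - k)) * X ^ k

theorem integrableOn_logit_pow (n : ℕ) :
    IntegrableOn (fun x => logit x ^ n) (Set.Ioo 0 1) :=
  integrable_pow_of_mem_interior_integrableExpSet zero_mem_interior_integrableExpSet_logit n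

theorem eval_logisticAppell (m : ℕ) (z : ℝ) :
    (logisticAppell m).eval z = ∫ x in Set.Ioo (0 : ℝ) 1, (z + logit x) ^ m := by
  simp only [add_pow]
  rw [integral_finsetSum _ fun k _ =>
    (((integrableOn_logit_pow (m - k)).const_mul (z ^ k)).mul_const _)]
  simp only [logisticAppell, eval_finsetSum, eval_mul, eval_C, eval_pow, eval_X]
  refine Finset.sum_congr rfl fun k _ => ?_
  rw [integral_mul_const, integral_const_mul]
  ring

theorem aeval_logisticAppell (m : ℕ) (w : ℂ) :
    aeval w (logisticAppell m) = iteratedDeriv m (fun s : ℂ => Complex.exp (w * s) *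
      complexMGF logit (volume.restrict (Set.Ioo 0 1)) s) 0 := by
  rw [iteratedDeriv_fun_mul (by fun_prop)
    (analyticAt_complexMGF (by simpa using zero_mem_interior_integrableExpSet_logit)).contDiffAt]
  simp only [logisticAppell, map_sum, map_mul, aeval_C, map_pow, aeval_X]
  refine Finset.sum_congr rfl fun k _ => ?_
  rw [iteratedDeriv_complexMGF (by simpa using zero_mem_interior_integrableExpSet_logit)]
  have h : ∫ x in Set.Ioo (0 : ℝ) 1, (logit x : ℂ) ^ (m - k) =
      ((∫ x in Set.Ioo (0 : ℝ) 1, logit x ^ (m - k) : ℝ) : ℂ) := by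
    rw [← integral_complex_ofReal]
    simp
  simp [iteratedDeriv_cexp_const_mul, h]
  ring

/-- In the generating function the two shifts contribute `2i sin(πs)`, which cancels the denominator
of the MGF and leaves `2πi s exp(ws)`. -/
theorem aeval_logisticAppell_sub (n : ℕ) (w : ℂ) :
    aeval (w + Real.pi * Complex.I) (logisticAppell (n + 1)) -
      aeval (w - Real.pi * Complex.I) (logisticAppell (n + 1)) =
      2 * Real.pi * Complex.I * (n + 1) * w ^ n := by
  have hM : ∀ v : ℂ, ContDiffAt ℂ (n + 1 : ℕ) (fun s : ℂ => Complex.exp (v * s) *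
      complexMGF logit (volume.restrict (Set.Ioo 0 1)) s) 0 := fun v =>
    ContDiffAt.mul (by fun_prop) (analyticAt_complexMGF
      (by simpa using zero_mem_interior_integrableExpSet_logit)).contDiffAt
  rw [aeval_logisticAppell, aeval_logisticAppell, ← iteratedDeriv_fun_sub (hM _) (hM _)]
  have hev : (fun s : ℂ => Complex.exp ((w + Real.pi * Complex.I) * s) *
        complexMGF logit (volume.restrict (Set.Ioo 0 1)) s -
      Complex.exp ((w - Real.pi * Complex.I) * s) *
        complexMGF logit (volume.restrict (Set.Ioo 0 1)) s) =ᶠ[nhds 0]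
      fun s => (2 * Real.pi * Complex.I * s) * Complex.exp (w * s) := by
    have ho : IsOpen {s : ℂ | -1 < s.re ∧ s.re < 1} :=
      (isOpen_lt continuous_const Complex.continuous_re).inter
        (isOpen_lt Complex.continuous_re continuous_const)
    filter_upwards [ho.mem_nhds (show (0 : ℂ) ∈ _ by simp)] with s hs
    have h := sin_mul_complexMGF_logit hs.1 hs.2
    have h2 := Complex.two_sin (Real.pi * s)
    have e1 : (w + Real.pi * Complex.I) * s = w * s + Real.pi * s * Complex.I := by ring
    have e2 : (w - Real.pi * Complex.I) * s = w * s + -(Real.pi * s) * Complex.I := by ring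
    rw [e1, e2, Complex.exp_add, Complex.exp_add]
    linear_combination 2 * Complex.I * Complex.exp (w * s) * h
      - Complex.I * Complex.exp (w * s) * complexMGF logit (volume.restrict (Set.Ioo 0 1)) s * h2
      - Complex.exp (w * s) * complexMGF logit (volume.restrict (Set.Ioo 0 1)) s *
        (Complex.exp (-(Real.pi * s) * Complex.I) - Complex.exp (Real.pi * s * Complex.I)) *
        Complex.I_sq
  -- In the Leibniz sum at 0, only the first derivative of the linear factor survives.
  rw [hev.iteratedDeriv_eq, iteratedDeriv_fun_mul (by fun_prop) (by fun_prop),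
    Finset.sum_eq_single 1]
  · simp [iteratedDeriv_one, iteratedDeriv_cexp_const_mul]
    left
    ring
  · intro k _ hk
    rcases k with _ | _ | k
    · simp
    · exact absurd rfl hk
    · have : iteratedDeriv (k + 1 + 1) (fun s : ℂ => 2 * Real.pi * Complex.I * s) 0 = 0 := by
        rw [iteratedDeriv_succ', iteratedDeriv_succ']
        simp
      rw [this]
      simp
  · simp

theorem pi_pow_mul_eval_polyA (n : ℕ) (z : ℝ) :
    Real.pi ^ (n + 1) * (polyA n).eval (z / Real.pi) =
      ((logisticAppell (n + 1)).eval z - (logisticAppell (n + 1)).eval 0) / (n + 1) := by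
  have hpi := Real.pi_ne_zero
  have hn : (n : ℝ) + 1 ≠ 0 := by positivity
  have hpi' : (Real.pi : ℂ) ≠ 0 := by exact_mod_cast hpi
  have hn' : (n : ℂ) + 1 ≠ 0 := by exact_mod_cast Nat.succ_ne_zero n
  have key : polyA n = C ((Real.pi ^ (n + 1) * (n + 1))⁻¹) *
      ((logisticAppell (n + 1)).comp (C Real.pi * X) - C ((logisticAppell (n + 1)).eval 0)) := by
    refine polyA_eq_of_aeval_sub (by simp [eval_comp]) fun w => ?_
    have h := aeval_logisticAppell_sub n (Real.pi * w)
    simp only [map_mul, map_sub, aeval_C, aeval_comp, aeval_X, Complex.coe_algebraMap, mul_add,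
      mul_sub]
    push_cast
    rw [← sub_eq_zero] at h ⊢
    field_simp
    rw [mul_add, mul_sub]
    linear_combination h
  rw [key]
  simp only [eval_mul, eval_C, eval_sub, eval_comp, eval_X, mul_div_cancel₀ z hpi]
  field_simp

/-! ### Changes of variable and logistic integrals -/

theorem sigmoid_eq_exp_div (u : ℝ) : Real.sigmoid u = Real.exp u / (Real.exp u + 1) := by
  rw [Real.sigmoid_def, Real.exp_neg]
  field_simp

theorem logit_sigmoid (u : ℝ) : logit (Real.sigmoid u) = u := by
  have h : Real.sigmoid u / (1 - Real.sigmoid u) = Real.exp u := by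
    rw [sigmoid_eq_exp_div]
    field_simp
    ring
  rw [logit, h, Real.log_exp]

theorem abs_sigmoid_mul_one_sub (u : ℝ) :
    |Real.sigmoid u * (1 - Real.sigmoid u)| = Real.sigmoid u * (1 - Real.sigmoid u) :=
  abs_of_nonneg (mul_nonneg (Real.sigmoid_nonneg u) (sub_nonneg.2 (Real.sigmoid_le_one u)))

theorem integrableOn_Ioo_iff_comp_sigmoid (g : ℝ → ℝ) :
    IntegrableOn g (Set.Ioo 0 1) ↔
      Integrable fun u => Real.sigmoid u * (1 - Real.sigmoid u) * g (Real.sigmoid u) := by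
  have h := integrableOn_image_iff_integrableOn_abs_deriv_smul MeasurableSet.univ
    (fun u _ => (Real.hasDerivAt_sigmoid u).hasDerivWithinAt) Real.sigmoid_injective.injOn g
  simpa only [Set.image_univ, Real.range_sigmoid, integrableOn_univ, abs_sigmoid_mul_one_sub,
    smul_eq_mul] using h

theorem integral_Ioo_eq_integral_comp_sigmoid (g : ℝ → ℝ) :
    ∫ x in Set.Ioo (0 : ℝ) 1, g x =
      ∫ u, Real.sigmoid u * (1 - Real.sigmoid u) * g (Real.sigmoid u) := by
  have h := integral_image_eq_integral_abs_deriv_smul MeasurableSet.univ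
    (fun u _ => (Real.hasDerivAt_sigmoid u).hasDerivWithinAt) Real.sigmoid_injective.injOn g
  simpa only [Set.image_univ, Real.range_sigmoid, Measure.restrict_univ, abs_sigmoid_mul_one_sub,
    smul_eq_mul] using h

theorem integrableOn_Ioi_iff_comp_exp (g : ℝ → ℝ) :
    IntegrableOn g (Set.Ioi 0) ↔ Integrable fun u => Real.exp u * g (Real.exp u) := by
  have h := integrableOn_image_iff_integrableOn_abs_deriv_smul MeasurableSet.univ
    (fun u _ => (Real.hasDerivAt_exp u).hasDerivWithinAt) Real.exp_injective.injOn g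
  simpa only [Set.image_univ, Real.range_exp, integrableOn_univ, Real.abs_exp, smul_eq_mul] using h

theorem integral_Ioi_eq_integral_comp_exp (g : ℝ → ℝ) :
    ∫ t in Set.Ioi (0 : ℝ), g t = ∫ u, Real.exp u * g (Real.exp u) := by
  have h := integral_image_eq_integral_abs_deriv_smul MeasurableSet.univ
    (fun u _ => (Real.hasDerivAt_exp u).hasDerivWithinAt) Real.exp_injective.injOn g
  simpa only [Set.image_univ, Real.range_exp, Measure.restrict_univ, Real.abs_exp,
    smul_eq_mul] using h

theorem integrable_add_pow_mul_logistic (n : ℕ) (z : ℝ) :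
    Integrable fun u => (z + u) ^ n * (Real.sigmoid u * (1 - Real.sigmoid u)) := by
  have h : IntegrableOn (fun x => (z + logit x) ^ n) (Set.Ioo 0 1) := by
    simp only [add_pow]
    exact integrable_finsetSum _ fun k _ =>
      ((integrableOn_logit_pow (n - k)).const_mul (z ^ k)).mul_const _
  rw [integrableOn_Ioo_iff_comp_sigmoid] at h
  simpa only [logit_sigmoid, mul_comm] using h

theorem integrable_pow_mul_logistic_sub (n : ℕ) (z : ℝ) :
    Integrable fun u => u ^ n * (Real.sigmoid (u - z) * (1 - Real.sigmoid (u - z))) := by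
  simpa using (integrable_add_pow_mul_logistic n z).comp_sub_right z

theorem integral_pow_mul_logistic_sub (n : ℕ) (z : ℝ) :
    ∫ u, u ^ n * (Real.sigmoid (u - z) * (1 - Real.sigmoid (u - z))) =
      (logisticAppell n).eval z := by
  have h := integral_sub_right_eq_self
    (fun u => (z + u) ^ n * (Real.sigmoid u * (1 - Real.sigmoid u))) (μ := volume) z
  simp only [add_sub_cancel] at h
  rw [h, eval_logisticAppell, integral_Ioo_eq_integral_comp_sigmoid]
  simp only [logit_sigmoid, mul_comm]

/-! ### The kernel and integration by parts -/

theorem sigmoid_sub_sub_sigmoid (u z : ℝ) :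
    Real.sigmoid (u - z) - Real.sigmoid u =
      (1 - Real.exp z) * (Real.exp u / ((Real.exp u + 1) * (Real.exp u + Real.exp z))) := by
  rw [sigmoid_eq_exp_div, sigmoid_eq_exp_div, Real.exp_sub]
  field_simp
  ring

theorem integrable_pow_mul_kernel (n : ℕ) (z : ℝ) :
    Integrable fun u : ℝ =>
      u ^ n * (Real.exp u / ((Real.exp u + 1) * (Real.exp u + Real.exp z))) := by
  have hc : Continuous fun u : ℝ =>
      u ^ n * (Real.exp u / ((Real.exp u + 1) * (Real.exp u + Real.exp z))) := by
    refine (continuous_pow n).mul (Real.continuous_exp.div (by fun_prop) fun u => ?_)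
    positivity
  -- The constant comes from `exp u + 1 ≤ (1 + exp(-z)) (exp u + exp z)`.
  refine ((integrable_pow_mul_logistic_sub n 0).const_mul (1 + (Real.exp z)⁻¹)).mono
    hc.aestronglyMeasurable (Filter.Eventually.of_forall fun u => ?_)
  have hu := Real.exp_pos u
  have hz := Real.exp_pos z
  rw [sub_zero, norm_mul, norm_mul, norm_mul, mul_left_comm]
  refine mul_le_mul_of_nonneg_left ?_ (norm_nonneg _)
  rw [Real.norm_of_nonneg (by positivity), Real.norm_of_nonneg (by positivity), Real.norm_eq_abs,
    abs_sigmoid_mul_one_sub, sigmoid_eq_exp_div]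
  have e : (1 + (Real.exp z)⁻¹) *
      (Real.exp u / (Real.exp u + 1) * (1 - Real.exp u / (Real.exp u + 1))) =
      Real.exp u * (1 + (Real.exp z)⁻¹) / ((Real.exp u + 1) * (Real.exp u + 1)) := by
    field_simp
    ring
  rw [e, div_le_div_iff₀ (by positivity) (by positivity)]
  have h : Real.exp u + 1 ≤ (1 + (Real.exp z)⁻¹) * (Real.exp u + Real.exp z) := by
    have : (Real.exp z)⁻¹ * Real.exp z = 1 := inv_mul_cancel₀ hz.ne'
    have : 0 < (Real.exp z)⁻¹ * Real.exp u := by positivity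
    nlinarith
  calc Real.exp u * ((Real.exp u + 1) * (Real.exp u + 1))
      = Real.exp u * (Real.exp u + 1) * (Real.exp u + 1) := by ring
    _ ≤ Real.exp u * (Real.exp u + 1) *
        ((1 + (Real.exp z)⁻¹) * (Real.exp u + Real.exp z)) := by gcongr
    _ = _ := by ring

theorem integral_pow_mul_kernel (n : ℕ) (z : ℝ) :
    (1 - Real.exp z) *
      ∫ u : ℝ, u ^ n * (Real.exp u / ((Real.exp u + 1) * (Real.exp u + Real.exp z))) =
      -(Real.pi ^ (n + 1) * (polyA n).eval (z / Real.pi)) := by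
  have hint : ∀ m : ℕ, Integrable fun u : ℝ =>
      u ^ m * (Real.sigmoid (u - z) - Real.sigmoid u) := fun m => by
    simp only [sigmoid_sub_sub_sigmoid, mul_left_comm (_ ^ m)]
    exact (integrable_pow_mul_kernel m z).const_mul _
  -- Writing `u - 0` lets one lemma evaluate both density terms.
  have hder : ∀ u : ℝ, HasDerivAt
      (fun u : ℝ => u ^ (n + 1) * (Real.sigmoid (u - z) - Real.sigmoid u))
      ((n + 1) * (u ^ n * (Real.sigmoid (u - z) - Real.sigmoid u)) +
        (u ^ (n + 1) * (Real.sigmoid (u - z) * (1 - Real.sigmoid (u - z))) -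
          u ^ (n + 1) * (Real.sigmoid (u - 0) * (1 - Real.sigmoid (u - 0))))) u := fun u => by
    have h := (hasDerivAt_pow (n + 1) u).mul
      (((Real.hasDerivAt_sigmoid (u - z)).comp_sub_const u z).sub (Real.hasDerivAt_sigmoid u))
    refine h.congr_deriv ?_
    simp
    ring
  have hl := integrable_pow_mul_logistic_sub (n + 1)
  have hs : Integrable fun u : ℝ =>
      u ^ (n + 1) * (Real.sigmoid (u - z) * (1 - Real.sigmoid (u - z))) -
        u ^ (n + 1) * (Real.sigmoid (u - 0) * (1 - Real.sigmoid (u - 0))) := (hl z).sub (hl 0)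
  -- Function and derivative are both integrable, so no boundary limits need computing.
  have h0 := integral_eq_zero_of_hasDerivAt_of_integrable hder
    (((hint n).const_mul _).add hs) (hint (n + 1))
  rw [integral_add ((hint n).const_mul _) hs, integral_sub (hl z) (hl 0),
    integral_const_mul, integral_pow_mul_logistic_sub, integral_pow_mul_logistic_sub] at h0
  have hn : (n : ℝ) + 1 ≠ 0 := by positivity
  rw [← integral_const_mul, pi_pow_mul_eval_polyA]
  simp only [mul_left_comm (1 - Real.exp z), ← sigmoid_sub_sub_sigmoid]
  field_simp
  linarith

/-- The condition on `a` makes `a / (1 + a)` positive, so it is `exp z` for a real `z`. -/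
theorem sigmoid_deriv_div_add {a : ℝ} (ha : 0 < a ∨ a < -1) (u : ℝ) :
    Real.sigmoid u * (1 - Real.sigmoid u) / (Real.sigmoid u + a) =
      (1 - Real.exp (Real.log (a / (1 + a)))) *
        (Real.exp u / ((Real.exp u + 1) * (Real.exp u + Real.exp (Real.log (a / (1 + a)))))) := by
  have hq : 0 < a / (1 + a) := by
    rcases ha with h | h
    · positivity
    · exact div_pos_of_neg_of_neg (by linarith) (by linarith)
  have ha1 : 1 + a ≠ 0 := by
    rcases ha with h | h <;> intro h' <;> linarith
  have hu := Real.exp_pos u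
  have hd : a + (1 + a) * Real.exp u ≠ 0 := by
    have e : a + (1 + a) * Real.exp u = (1 + a) * (a / (1 + a) + Real.exp u) := by field_simp
    rw [e]
    exact mul_ne_zero ha1 (by positivity)
  have e1 : Real.exp u / (Real.exp u + 1) + a =
      (a + (1 + a) * Real.exp u) / (Real.exp u + 1) := by
    field_simp
    ring
  have e2 : Real.exp u + a / (1 + a) = (a + (1 + a) * Real.exp u) / (1 + a) := by
    field_simp
    ring
  rw [Real.exp_log hq, sigmoid_eq_exp_div, e1, e2]
  field_simp
  ring

theorem mainTheorem7 (n : ℕ) :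
    (∀ z : ℝ,
      MeasureTheory.IntegrableOn
          (fun t : ℝ => Real.log t ^ n / ((t + 1) * (t + Real.exp z))) (Set.Ioi 0) ∧
      (1 - Real.exp z) *
          ∫ t in Set.Ioi (0 : ℝ), Real.log t ^ n / ((t + 1) * (t + Real.exp z)) =
        -(Real.pi ^ (n + 1) * (polyA n).eval (z / Real.pi))) ∧
    (∀ a : ℝ, (0 < a ∨ a < -1) →
      IntervalIntegrable
          (fun x : ℝ => Real.log (x / (1 - x)) ^ n / (x + a)) MeasureTheory.volume 0 1 ∧
      ∫ x in (0 : ℝ)..1, Real.log (x / (1 - x)) ^ n / (x + a) =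
        -(Real.pi ^ (n + 1) * (polyA n).eval (Real.log (a / (1 + a)) / Real.pi))) := by
  refine ⟨fun z => ?_, fun a ha => ?_⟩
  · rw [integrableOn_Ioi_iff_comp_exp, integral_Ioi_eq_integral_comp_exp]
    simp only [Real.log_exp, mul_div_left_comm (Real.exp _)]
    exact ⟨integrable_pow_mul_kernel n z, integral_pow_mul_kernel n z⟩
  · have h : ∀ u : ℝ, Real.sigmoid u * (1 - Real.sigmoid u) *
        (logit (Real.sigmoid u) ^ n / (Real.sigmoid u + a)) =
        (1 - Real.exp (Real.log (a / (1 + a)))) * (u ^ n * (Real.exp u /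
          ((Real.exp u + 1) * (Real.exp u + Real.exp (Real.log (a / (1 + a))))))) := fun u => by
      rw [logit_sigmoid, mul_left_comm _ (u ^ n), ← sigmoid_deriv_div_add ha]
      ring
    rw [intervalIntegrable_iff_integrableOn_Ioo_of_le zero_le_one,
      intervalIntegral.integral_of_le zero_le_one, integral_Ioc_eq_integral_Ioo]
    change IntegrableOn (fun x => logit x ^ n / (x + a)) _ ∧
      ∫ x in Set.Ioo (0 : ℝ) 1, logit x ^ n / (x + a) = _
    rw [integrableOn_Ioo_iff_comp_sigmoid, integral_Ioo_eq_integral_comp_sigmoid]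
    simp only [h]
    rw [integral_const_mul]
    exact ⟨(integrable_pow_mul_kernel n _).const_mul _, integral_pow_mul_kernel n _⟩
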